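/- Let $\mathbb K$ be $\mathbb R$ or $\mathbb C$, and for $1\le r<\infty$ let $\ell_r$ be the Banach space of $r$-summable sequences in $\mathbb K$ with its usual norm. A bounded linear operator $T\colon\ell_p\to\ell_q$ is norm attaining if $\|T v\|=\|T\|$ for some $v\in\ell_p$ with $\|v\|=1$. A maximizing sequence for $T$ is a sequence $(u^n)$ in $\ell_p$ with $\|u^n\|=1$ for all $n$ and $\|T u^n\|\to\|T\|$; it is weakly null if it converges weakly to $0$ in $\ell_p$. Let $1<p<\infty$, $1\le q<\infty$ with $p\ne q$, and let $T\colon\ell_p\to\ell_q$ be a nonzero norm attaining bounded linear operator. Then every maximizing sequence for $T$ that is not weakly null has a subsequence converging in the norm of $\ell_p$. The statement fails when $p=q$: for every $1<p<\infty$, the identity operator $\mathrm{Id}\colon\ell_p\to\ell_p$ is nonzero and norm attaining, and it has a maximizing sequence that is not weakly null and has no norm-convergent subsequence. -/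

import Mathlib

open Filter Topology
open scoped ENNReal

/-- The classical sequence space `ℓ_p` over the scalar field `𝕜`, indexed by `ℕ`. -/
abbrev SeqLp (𝕜 : Type*) [RCLike 𝕜] (p : ℝ≥0∞) : Type _ :=
  lp (fun _ : ℕ => 𝕜) p

section

variable {𝕜 : Type*} [RCLike 𝕜]
  {E : Type*} [NormedAddCommGroup E] [NormedSpace 𝕜 E]
  {F : Type*} [NormedAddCommGroup F] [NormedSpace 𝕜 F]

/-- A bounded linear operator attains its norm if `‖T v‖ = ‖T‖` for some unit vector `v`. -/
def AttainsNorm (T : E →L[𝕜] F) : Prop :=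
  ∃ v : E, ‖v‖ = 1 ∧ ‖T v‖ = ‖T‖

/-- A maximizing sequence for `T`: unit vectors `u n` with `‖T (u n)‖ → ‖T‖`. -/
def IsMaximizingSeq (T : E →L[𝕜] F) (u : ℕ → E) : Prop :=
  (∀ n, ‖u n‖ = 1) ∧ Tendsto (fun n => ‖T (u n)‖) atTop (𝓝 ‖T‖)

variable (𝕜) in
/-- A sequence is weakly null if every bounded linear functional tends to `0` along it. -/
def IsWeaklyNull (u : ℕ → E) : Prop :=
  ∀ f : StrongDual 𝕜 E, Tendsto (fun n => f (u n)) atTop (𝓝 0)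

/-- The sequence has a subsequence converging in norm to some vector of the space. -/
def HasNormConvergentSubseq (u : ℕ → E) : Prop :=
  ∃ (v : E) (φ : ℕ → ℕ), StrictMono φ ∧ Tendsto (fun k => u (φ k)) atTop (𝓝 v)

end

/-!
The proof rests on the additivity of `‖·‖ ^ p` in the limit (the Brezis–Lieb phenomenon): if `w n`
tends to `0` coordinatewise in `ℓ_p` and `‖w n‖ → b`, then `‖x + w n‖ ^ p → ‖x‖ ^ p + b ^ p` for
every `x` (`tendsto_norm_add_rpow`). For finitely supported `x` this is a computation, and the
general case follows since the functions `x ↦ ‖x + w n‖` are all `1`-Lipschitz.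

As `p > 1`, a bounded sequence in `ℓ_p` that tends to `0` coordinatewise is weakly null
(`isWeaklyNull_of_tendsto_apply`). So a maximizing sequence that is not weakly null has a
subsequence of the form `x + w n` with `x ≠ 0`, with both `w n` and `T (w n)` tending to `0`
coordinatewise, and with `‖w n‖ → b`, `‖T (w n)‖ → c`. The Brezis–Lieb lemma in `ℓ_p` and in `ℓ_q`
gives `‖x‖ ^ p + b ^ p = 1` and `‖T x‖ ^ q + c ^ q = ‖T‖ ^ q`, and it remains to see that `b = 0`.

* If `p < q`, then `1 ≤ ‖x‖ ^ q + b ^ q`, which together with `‖x‖ ^ p + b ^ p = 1` and `x ≠ 0`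
  forces `b = 0`.
* If `q < p`, testing `T` on `v + t • w n`, where `T` attains its norm at the unit vector `v`, gives
  `‖T‖ ^ q + (t * c) ^ q ≤ ‖T‖ ^ q * (1 + (t * b) ^ p) ^ (q / p)` for all `t > 0`. The right side is
  `‖T‖ ^ q + O(t ^ p)`, so `c = 0` (`eq_zero_of_forall_perturbation`). Then `‖T x‖ = ‖T‖`, hence
  `‖x‖ ≥ 1` and `b = 0`.

The same perturbation inequality, with exponent `1` in place of `q` and almost norming vectors in
place of `v`, proves the weak nullity statement.

For the identity of `ℓ_p`, normalized sums `e_0 + e_{n+1}` give the counterexample.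
-/

/-! ### The perturbation inequality -/

/-- A perturbation of size `t ^ s` on the left cannot be compensated by one of size `t ^ r` with
`s < r` on the right, as `t → 0`. -/
theorem eq_zero_of_forall_perturbation {r s M b c : ℝ} (hs : 0 < s) (hsr : s < r) (hM : 0 ≤ M)
    (hb : 0 ≤ b) (hc : 0 ≤ c)
    (h : ∀ t : ℝ, 0 < t → M + (t * c) ^ s ≤ M * (1 + (t * b) ^ r) ^ (s / r)) : c = 0 := by
  have hr : 0 < r := hs.trans hsr
  have key : ∀ t : ℝ, 0 < t → c ^ s ≤ M * b ^ r * t ^ (r - s) := by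
    intro t ht
    have hnn : 0 ≤ (t * b) ^ r := by positivity
    have h1 : (1 + (t * b) ^ r) ^ (s / r) ≤ 1 + (t * b) ^ r := by
      conv_rhs => rw [← Real.rpow_one (1 + (t * b) ^ r)]
      exact Real.rpow_le_rpow_of_exponent_le (by linarith) ((div_le_one hr).2 hsr.le)
    have h2 : (t * c) ^ s ≤ M * (t * b) ^ r := by
      have := (h t ht).trans (mul_le_mul_of_nonneg_left h1 hM)
      linarith
    rw [Real.mul_rpow ht.le hc, Real.mul_rpow ht.le hb] at h2
    have hts : 0 < t ^ s := Real.rpow_pos_of_pos ht s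
    rw [Real.rpow_sub ht, mul_div_assoc', le_div_iff₀ hts]
    linarith
  have hlim : Tendsto (fun t : ℝ => M * b ^ r * t ^ (r - s)) (𝓝[>] 0) (𝓝 0) := by
    have : Tendsto (fun t : ℝ => t ^ (r - s)) (𝓝[>] 0) (𝓝 ((0 : ℝ) ^ (r - s))) :=
      (Real.continuousAt_rpow_const 0 (r - s) (Or.inr (sub_pos.2 hsr).le)).tendsto.mono_left
        nhdsWithin_le_nhds
    rw [Real.zero_rpow (sub_pos.2 hsr).ne'] at this
    simpa using this.const_mul (M * b ^ r)
  have hle : c ^ s ≤ 0 :=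
    ge_of_tendsto hlim (eventually_mem_nhdsWithin.mono fun t ht => key t ht)
  by_contra hne
  exact absurd (Real.rpow_pos_of_pos (lt_of_le_of_ne hc (Ne.symm hne)) s) (not_lt.2 hle)

/-! ### Coordinatewise null sequences in `ℓ_p` -/

section

variable {𝕜 : Type*} [RCLike 𝕜] {p : ℝ≥0∞} [Fact (1 ≤ p)]

theorem SeqLp.toReal_pos (hp : p ≠ ∞) : 0 < p.toReal :=
  ENNReal.toReal_pos (zero_lt_one.trans_le Fact.out).ne' hp

/-- The Brezis–Lieb lemma for a finitely supported vector, written as `∑ i ∈ s, x i e_i`. -/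
theorem tendsto_norm_sum_single_add_rpow (hp : p ≠ ∞) {w : ℕ → SeqLp 𝕜 p} {b : ℝ}
    (hw : ∀ i, Tendsto (fun n => w n i) atTop (𝓝 0))
    (hb : Tendsto (fun n => ‖w n‖) atTop (𝓝 b)) (x : ℕ → 𝕜) (s : Finset ℕ) :
    Tendsto (fun n => ‖(∑ i ∈ s, lp.single p i (x i) : SeqLp 𝕜 p) + w n‖ ^ p.toReal) atTop
      (𝓝 (‖(∑ i ∈ s, lp.single p i (x i) : SeqLp 𝕜 p)‖ ^ p.toReal + b ^ p.toReal)) := by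
  have hr := SeqLp.toReal_pos hp
  set y : SeqLp 𝕜 p := ∑ i ∈ s, lp.single p i (x i) with hy
  have hyi : ∀ i ∈ s, y i = x i := fun i hi => by
    simp only [hy, lp.coeFn_sum, lp.coeFn_single, Finset.sum_apply, Finset.sum_pi_single, if_pos hi]
  have hsplit : ∀ n, ‖y + w n‖ ^ p.toReal =
      ∑ i ∈ s, ‖x i + w n i‖ ^ p.toReal + (‖w n‖ ^ p.toReal - ∑ i ∈ s, ‖w n i‖ ^ p.toReal) := by
    intro n
    have h1 := lp.norm_sub_norm_compl_sub_single hr (y + w n) s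
    have h2 := lp.norm_sub_norm_compl_sub_single hr (w n) s
    -- Removing the coordinates in `s` from `y + w n` and from `w n` leaves the same vector.
    have h3 : y + w n - ∑ i ∈ s, lp.single p i ((y + w n) i) =
        w n - ∑ i ∈ s, lp.single p i (w n i) := by
      have : ∑ i ∈ s, lp.single p i ((y + w n) i) =
          y + ∑ i ∈ s, (lp.single p i (w n i) : SeqLp 𝕜 p) := by
        rw [hy, ← Finset.sum_add_distrib]
        refine Finset.sum_congr rfl fun i hi => ?_
        rw [← lp.single_add, ← hyi i hi]
        rfl
      rw [this]; abel
    have h4 : ∑ i ∈ s, ‖(y + w n) i‖ ^ p.toReal = ∑ i ∈ s, ‖x i + w n i‖ ^ p.toReal :=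
      Finset.sum_congr rfl fun i hi => by rw [← hyi i hi]; rfl
    rw [h3, h4] at h1
    linarith
  simp only [hsplit]
  rw [hy, lp.norm_sum_single hr x s]
  have hcont : Continuous fun z : ℝ => z ^ p.toReal := Real.continuous_rpow_const hr.le
  have t1 : Tendsto (fun n => ∑ i ∈ s, ‖x i + w n i‖ ^ p.toReal) atTop
      (𝓝 (∑ i ∈ s, ‖x i‖ ^ p.toReal)) := by
    refine tendsto_finsetSum s fun i _ => ?_
    have : Tendsto (fun n => ‖x i + w n i‖) atTop (𝓝 ‖x i‖) := by
      simpa using ((hw i).const_add (x i)).norm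
    exact (hcont.tendsto _).comp this
  have t2 : Tendsto (fun n => ∑ i ∈ s, ‖w n i‖ ^ p.toReal) atTop (𝓝 0) := by
    have : Tendsto (fun n => ∑ i ∈ s, ‖w n i‖ ^ p.toReal) atTop (𝓝 (∑ i ∈ s, (0 : ℝ))) := by
      refine tendsto_finsetSum s fun i _ => ?_
      have h0 := (hcont.tendsto _).comp (hw i).norm
      simpa [Real.zero_rpow hr.ne', Function.comp_def] using h0
    simpa using this
  simpa using t1.add (((hcont.tendsto _).comp hb).sub t2)

/-- The Brezis–Lieb lemma in `ℓ_p`. -/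
theorem tendsto_norm_add_rpow (hp : p ≠ ∞) {w : ℕ → SeqLp 𝕜 p} {b : ℝ}
    (hw : ∀ i, Tendsto (fun n => w n i) atTop (𝓝 0))
    (hb : Tendsto (fun n => ‖w n‖) atTop (𝓝 b)) (x : SeqLp 𝕜 p) :
    Tendsto (fun n => ‖x + w n‖ ^ p.toReal) atTop (𝓝 (‖x‖ ^ p.toReal + b ^ p.toReal)) := by
  have hr := SeqLp.toReal_pos hp
  have hb0 : 0 ≤ b := ge_of_tendsto' hb fun n => norm_nonneg _
  have hnn : ∀ y : SeqLp 𝕜 p, 0 ≤ ‖y‖ ^ p.toReal + b ^ p.toReal := fun y => by positivity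
  -- Without the power, the functions of `x` are equicontinuous, so convergence is a closed condition.
  have hclosed : IsClosed {y : SeqLp 𝕜 p | Tendsto (fun n => ‖y + w n‖) atTop
      (𝓝 ((‖y‖ ^ p.toReal + b ^ p.toReal) ^ p.toReal⁻¹))} := by
    refine Equicontinuous.isClosed_setOfPred_tendsto (F := fun n (y : SeqLp 𝕜 p) => ‖y + w n‖) ?_ ?_
    · refine (LipschitzWith.uniformEquicontinuous _ 1 fun n => ?_).equicontinuous
      refine LipschitzWith.of_dist_le_mul fun y z => ?_
      rw [Real.dist_eq, dist_eq_norm, NNReal.coe_one, one_mul]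
      simpa using abs_norm_sub_norm_le (y + w n) (z + w n)
    · exact ((continuous_norm.rpow_const fun _ => Or.inr hr.le).add continuous_const).rpow_const
        fun _ => Or.inr (inv_pos.2 hr).le
  have hmem := hclosed.mem_of_tendsto (lp.hasSum_single hp x) (Eventually.of_forall fun s => by
    have := ((Real.continuous_rpow_const (inv_pos.2 hr).le).tendsto _).comp
      (tendsto_norm_sum_single_add_rpow hp hw hb x s)
    refine this.congr fun n => ?_
    exact Real.rpow_rpow_inv (norm_nonneg _) hr.ne')
  have := ((Real.continuous_rpow_const hr.le).tendsto _).comp hmem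
  rwa [Real.rpow_inv_rpow (hnn x) hr.ne'] at this

/-- The Brezis–Lieb lemma for the rescaled sequence `t • w n`. -/
theorem tendsto_norm_add_smul_rpow (hp : p ≠ ∞) {w : ℕ → SeqLp 𝕜 p} {b : ℝ}
    (hw : ∀ i, Tendsto (fun n => w n i) atTop (𝓝 0))
    (hb : Tendsto (fun n => ‖w n‖) atTop (𝓝 b)) (x : SeqLp 𝕜 p) {t : ℝ} (ht : 0 ≤ t) :
    Tendsto (fun n => ‖x + (t : 𝕜) • w n‖ ^ p.toReal) atTop
      (𝓝 (‖x‖ ^ p.toReal + (t * b) ^ p.toReal)) := by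
  refine tendsto_norm_add_rpow hp (fun i => ?_) ?_ x
  · have h := (hw i).const_mul (t : 𝕜)
    rwa [mul_zero] at h
  · simpa [norm_smul, abs_of_nonneg ht] using hb.const_mul t

/-- The limiting form of `‖T (x + t • w n)‖ ≤ ‖T‖ * ‖x + t • w n‖`. -/
theorem le_opNorm_rpow_of_tendsto {F : Type*} [NormedAddCommGroup F] [NormedSpace 𝕜 F]
    (hp : p ≠ ∞) (T : SeqLp 𝕜 p →L[𝕜] F) {w : ℕ → SeqLp 𝕜 p} {b : ℝ}
    (hw : ∀ i, Tendsto (fun n => w n i) atTop (𝓝 0))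
    (hb : Tendsto (fun n => ‖w n‖) atTop (𝓝 b)) (x : SeqLp 𝕜 p) {s t L : ℝ} (hs : 0 ≤ s)
    (ht : 0 ≤ t) (hL : Tendsto (fun n => ‖T (x + (t : 𝕜) • w n)‖ ^ s) atTop (𝓝 L)) :
    L ≤ ‖T‖ ^ s * (‖x‖ ^ p.toReal + (t * b) ^ p.toReal) ^ (s / p.toReal) := by
  have hr := SeqLp.toReal_pos hp
  refine le_of_tendsto_of_tendsto' hL
    ((((Real.continuous_rpow_const (div_nonneg hs hr.le)).tendsto _).comp
      (tendsto_norm_add_smul_rpow hp hw hb x ht)).const_mul (‖T‖ ^ s)) fun n => ?_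
  simp only [Function.comp_apply]
  rw [← Real.rpow_mul (norm_nonneg _), mul_div_cancel₀ _ hr.ne',
    ← Real.mul_rpow (norm_nonneg _) (norm_nonneg _)]
  exact Real.rpow_le_rpow (norm_nonneg _) (T.le_opNorm _) hs

theorem RCLike.exists_norm_eq_one_norm_mul_add (z c : 𝕜) :
    ∃ a : 𝕜, ‖a‖ = 1 ∧ ‖a * z + c‖ = ‖z‖ + ‖c‖ := by
  obtain ⟨α, hα, hz⟩ := RCLike.exists_norm_eq_mul_self z
  obtain ⟨β, hβ, hc⟩ := RCLike.exists_norm_eq_mul_self c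
  refine ⟨β⁻¹ * α, by simp [hα, hβ], ?_⟩
  have hβ0 : β ≠ 0 := by rintro rfl; simp at hβ
  have : β⁻¹ * α * z + c = β⁻¹ * ((‖z‖ + ‖c‖ : ℝ) : 𝕜) := by
    rw [RCLike.ofReal_add, hz, hc]
    field_simp
  rw [this, norm_mul, norm_inv, hβ, inv_one, one_mul, RCLike.norm_ofReal,
    abs_of_nonneg (by positivity)]

/-- In `ℓ_p` with `1 < p < ∞`, coordinatewise null sequences whose norms converge are weakly null,
at least if the functional converges along them. -/
theorem eq_zero_of_tendsto_strongDual (hp1 : 1 < p) (hp : p ≠ ∞) {w : ℕ → SeqLp 𝕜 p} {b : ℝ}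
    (hw : ∀ i, Tendsto (fun n => w n i) atTop (𝓝 0))
    (hb : Tendsto (fun n => ‖w n‖) atTop (𝓝 b)) (f : StrongDual 𝕜 (SeqLp 𝕜 p)) {c : 𝕜}
    (hc : Tendsto (fun n => f (w n)) atTop (𝓝 c)) : c = 0 := by
  have hr := SeqLp.toReal_pos hp
  have hr1 : 1 < p.toReal := by
    rw [← ENNReal.toReal_one]; exact (ENNReal.toReal_lt_toReal ENNReal.one_ne_top hp).2 hp1
  have hb0 : 0 ≤ b := ge_of_tendsto' hb fun n => norm_nonneg _
  rw [← norm_eq_zero]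
  refine eq_zero_of_forall_perturbation one_pos hr1 (norm_nonneg f) hb0 (norm_nonneg c)
    fun t ht => ?_
  rw [Real.rpow_one, ← le_sub_iff_add_le]
  refine le_of_forall_lt fun ρ hρ => ?_
  obtain ⟨x, hx, hfx⟩ := f.exists_lt_apply_of_lt_opNorm hρ
  -- Rotate `x` so that `f x` and the limit of `f (t • w n)` point in the same direction.
  obtain ⟨a, ha, hac⟩ := RCLike.exists_norm_eq_one_norm_mul_add (f x) ((t : 𝕜) * c)
  have hL : Tendsto (fun n => ‖f (a • x + (t : 𝕜) • w n)‖ ^ (1 : ℝ)) atTop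
      (𝓝 (‖f x‖ + t * ‖c‖)) := by
    have := ((hc.const_mul (t : 𝕜)).const_add (a * f x)).norm
    rw [hac, norm_mul, RCLike.norm_ofReal, abs_of_pos ht] at this
    simpa only [Real.rpow_one, map_add, map_smul, smul_eq_mul] using this
  have := le_opNorm_rpow_of_tendsto hp f hw hb (a • x) zero_le_one ht.le hL
  rw [norm_smul, ha, one_mul, Real.rpow_one] at this
  have hmono : (‖x‖ ^ p.toReal + (t * b) ^ p.toReal) ^ (1 / p.toReal) ≤
      (1 + (t * b) ^ p.toReal) ^ (1 / p.toReal) := by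
    have := Real.rpow_le_one (norm_nonneg x) hx.le hr.le
    gcongr
  have := this.trans (mul_le_mul_of_nonneg_left hmono (norm_nonneg f))
  linarith

/-- In `ℓ_p` with `1 < p < ∞`, bounded coordinatewise null sequences are weakly null. -/
theorem isWeaklyNull_of_tendsto_apply (hp1 : 1 < p) (hp : p ≠ ∞) {w : ℕ → SeqLp 𝕜 p} {C : ℝ}
    (hw : ∀ i, Tendsto (fun n => w n i) atTop (𝓝 0)) (hC : ∀ n, ‖w n‖ ≤ C) :
    IsWeaklyNull 𝕜 w := by
  intro f
  refine tendsto_of_subseq_tendsto fun φ hφ => ?_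
  obtain ⟨z, -, ψ, hψ, hz⟩ := ((isCompact_Icc (a := (0 : ℝ)) (b := C)).prod
    (isCompact_closedBall (0 : 𝕜) (‖f‖ * C))).tendsto_subseq
      (x := fun n => (‖w (φ n)‖, f (w (φ n)))) fun n => ⟨⟨norm_nonneg _, hC _⟩, by
        rw [mem_closedBall_zero_iff]
        exact f.le_opNorm_of_le (hC _)⟩
  have hφψ := hφ.comp hψ.tendsto_atTop
  have h2 := hz.snd_nhds
  have h0 := eq_zero_of_tendsto_strongDual hp1 hp (fun i => (hw i).comp hφψ) hz.fst_nhds f h2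
  exact ⟨ψ, h0 ▸ h2⟩

/-- Coordinatewise sequential compactness of bounded sets in `ℓ_p`. -/
theorem exists_subseq_tendsto_apply {u : ℕ → SeqLp 𝕜 p} {C : ℝ} (hC : ∀ n, ‖u n‖ ≤ C) :
    ∃ (x : SeqLp 𝕜 p) (φ : ℕ → ℕ), StrictMono φ ∧
      ∀ i, Tendsto (fun n => u (φ n) i) atTop (𝓝 (x i)) := by
  have hp0 : p ≠ 0 := (zero_lt_one.trans_le Fact.out).ne'
  obtain ⟨x, -, φ, hφ, hx⟩ := (isCompact_univ_pi fun _ : ℕ =>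
    isCompact_closedBall (0 : 𝕜) C).tendsto_subseq (x := fun n i => u n i) fun n i _ => by
      rw [mem_closedBall_zero_iff]
      exact (lp.norm_apply_le_norm hp0 (u n) i).trans (hC n)
  have hbdd : Bornology.IsBounded (Set.range (u ∘ φ)) :=
    isBounded_iff_forall_norm_le.2 ⟨C, by rintro _ ⟨n, rfl⟩; exact hC _⟩
  exact ⟨⟨x, lp.memℓp_of_tendsto hbdd hx⟩, φ, hφ, fun i => (tendsto_pi_nhds.1 hx) i⟩

end

/-! ### Maximizing sequences for `p ≠ q` -/

section

variable {𝕜 : Type*} [RCLike 𝕜] {p q : ℝ≥0∞} [Fact (1 ≤ p)] [Fact (1 ≤ q)]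

/-- If `q < p`, an operator `ℓ_p → ℓ_q` attaining its norm maps weakly null sequences to norm null
ones (an instance of Pitt's theorem); here `w n` and `T (w n)` are coordinatewise null, with
convergent norms. -/
theorem eq_zero_of_attainsNorm (hp : p ≠ ∞) (hq : q ≠ ∞) (hqp : q.toReal < p.toReal)
    {T : SeqLp 𝕜 p →L[𝕜] SeqLp 𝕜 q} (hT : AttainsNorm T) {w : ℕ → SeqLp 𝕜 p} {b c : ℝ}
    (hw : ∀ i, Tendsto (fun n => w n i) atTop (𝓝 0))
    (hTw : ∀ i, Tendsto (fun n => T (w n) i) atTop (𝓝 0))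
    (hb : Tendsto (fun n => ‖w n‖) atTop (𝓝 b))
    (hc : Tendsto (fun n => ‖T (w n)‖) atTop (𝓝 c)) : c = 0 := by
  have hs := SeqLp.toReal_pos hq
  obtain ⟨v, hv, hTv⟩ := hT
  refine eq_zero_of_forall_perturbation (M := ‖T‖ ^ q.toReal) hs hqp (by positivity)
    (ge_of_tendsto' hb fun n => norm_nonneg _) (ge_of_tendsto' hc fun n => norm_nonneg _)
    fun t ht => ?_
  have hL : Tendsto (fun n => ‖T (v + (t : 𝕜) • w n)‖ ^ q.toReal) atTop
      (𝓝 (‖T‖ ^ q.toReal + (t * c) ^ q.toReal)) := by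
    simpa [hTv] using tendsto_norm_add_smul_rpow hq hTw hc (T v) ht.le
  simpa [hv] using le_opNorm_rpow_of_tendsto hp T hw hb v hs.le ht.le hL

/-- If `a ^ r + b ^ r = 1` and `a > 0`, then `a ^ s + b ^ s ≥ 1` with `s > r` only if `b = 0`. -/
theorem eq_zero_of_rpow_add_rpow {r s a b : ℝ} (hr : 0 < r) (hrs : r < s) (ha : 0 < a)
    (hb : 0 ≤ b) (h1 : a ^ r + b ^ r = 1) (h2 : 1 ≤ a ^ s + b ^ s) : b = 0 := by
  by_contra hne
  have hb' : 0 < b := lt_of_le_of_ne hb (Ne.symm hne)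
  have har := Real.rpow_pos_of_pos ha r
  have hbr := Real.rpow_pos_of_pos hb' r
  have ha1 : a < 1 := by
    by_contra h
    linarith [Real.one_le_rpow (not_lt.1 h) hr.le]
  have hb1 : b < 1 := by
    by_contra h
    linarith [Real.one_le_rpow (not_lt.1 h) hr.le]
  linarith [Real.rpow_lt_rpow_of_exponent_gt ha ha1 hrs,
    Real.rpow_lt_rpow_of_exponent_gt hb' hb1 hrs]

theorem hasNormConvergentSubseq_of_isMaximizingSeq (hp1 : 1 < p) (hp : p ≠ ∞) (hq : q ≠ ∞)
    (hpq : p ≠ q) {T : SeqLp 𝕜 p →L[𝕜] SeqLp 𝕜 q} (hT0 : T ≠ 0) (hT : AttainsNorm T)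
    {u : ℕ → SeqLp 𝕜 p} (hu : IsMaximizingSeq T u) (hwn : ¬ IsWeaklyNull 𝕜 u) :
    HasNormConvergentSubseq u := by
  have hr := SeqLp.toReal_pos hp
  have hs := SeqLp.toReal_pos hq
  obtain ⟨hu1, hmax⟩ := hu
  obtain ⟨f, hf⟩ := not_forall.1 hwn
  -- Stay away from zero under `f` along a subsequence `φ`.
  obtain ⟨ε, hε, hfreq⟩ : ∃ ε > 0, ∃ᶠ n in atTop, ε ≤ ‖f (u n)‖ := by
    by_contra! h
    refine hf (Metric.tendsto_nhds.2 fun ε hε => ?_)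
    filter_upwards [h ε hε] with n hn
    simpa using hn
  obtain ⟨φ, hφ, hφε⟩ := extraction_of_frequently_atTop hfreq
  obtain ⟨x, ψ, hψ, hx⟩ := exists_subseq_tendsto_apply (u := u ∘ φ) fun n => (hu1 _).le
  set w : ℕ → SeqLp 𝕜 p := fun n => u (φ (ψ n)) - x with hwdef
  have hw : ∀ i, Tendsto (fun n => w n i) atTop (𝓝 0) := fun i => by
    simpa [hwdef] using (hx i).sub_const (x i)
  have hwC : ∀ n, ‖w n‖ ≤ 1 + ‖x‖ := fun n => (norm_sub_le _ _).trans (by rw [hu1])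
  have hwnull := isWeaklyNull_of_tendsto_apply hp1 hp hw hwC
  have hx0 : x ≠ 0 := by
    rintro rfl
    refine absurd (ge_of_tendsto' (hwnull f).norm fun n => ?_) (not_le.2 (norm_zero (E := 𝕜) ▸ hε))
    simpa [hwdef] using hφε (ψ n)
  have hTw : ∀ i, Tendsto (fun n => T (w n) i) atTop (𝓝 0) := fun i =>
    hwnull ((lp.evalCLM 𝕜 (fun _ : ℕ => 𝕜) q i).comp T)
  obtain ⟨⟨b, c⟩, -, θ, hθ, hbc⟩ := ((isCompact_Icc (a := (0 : ℝ)) (b := 1 + ‖x‖)).prod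
    (isCompact_Icc (a := (0 : ℝ)) (b := ‖T‖ * (1 + ‖x‖)))).tendsto_subseq
      (x := fun n => (‖w n‖, ‖T (w n)‖)) fun n =>
        ⟨⟨norm_nonneg _, hwC n⟩, ⟨norm_nonneg _, T.le_opNorm_of_le (hwC n)⟩⟩
  have hb : Tendsto (fun n => ‖w (θ n)‖) atTop (𝓝 b) := hbc.fst_nhds
  have hc : Tendsto (fun n => ‖T (w (θ n))‖) atTop (𝓝 c) := hbc.snd_nhds
  have hw' := fun i => (hw i).comp hθ.tendsto_atTop
  have hTw' := fun i => (hTw i).comp hθ.tendsto_atTop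
  have hb0 : 0 ≤ b := ge_of_tendsto' hb fun n => norm_nonneg _
  have hmono : StrictMono fun n => φ (ψ (θ n)) := hφ.comp (hψ.comp hθ)
  have hsum : ‖x‖ ^ p.toReal + b ^ p.toReal = 1 := by
    refine tendsto_nhds_unique (tendsto_norm_add_rpow hp hw' hb x) ?_
    simp [hwdef, hu1]
  have hTsum : ‖T x‖ ^ q.toReal + c ^ q.toReal = ‖T‖ ^ q.toReal := by
    refine tendsto_nhds_unique (tendsto_norm_add_rpow hq hTw' hc (T x)) ?_
    have := ((Real.continuous_rpow_const hs.le).tendsto _).comp (hmax.comp hmono.tendsto_atTop)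
    simpa [hwdef, Function.comp_def] using this
  have hTpos : 0 < ‖T‖ := norm_pos_iff.2 hT0
  have hb_zero : b = 0 := by
    rcases lt_or_gt_of_ne (mt (ENNReal.toReal_eq_toReal_iff' hp hq).1 hpq) with hlt | hgt
    · refine eq_zero_of_rpow_add_rpow hr hlt (norm_pos_iff.2 hx0) hb0 hsum ?_
      have hcb : c ≤ ‖T‖ * b := le_of_tendsto_of_tendsto' hc (hb.const_mul _) fun n => T.le_opNorm _
      have hc0 : 0 ≤ c := ge_of_tendsto' hc fun n => norm_nonneg _
      have h1 : ‖T x‖ ^ q.toReal ≤ ‖T‖ ^ q.toReal * ‖x‖ ^ q.toReal := by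
        rw [← Real.mul_rpow (norm_nonneg _) (norm_nonneg _)]
        exact Real.rpow_le_rpow (norm_nonneg _) (T.le_opNorm x) hs.le
      have h2 : c ^ q.toReal ≤ ‖T‖ ^ q.toReal * b ^ q.toReal := by
        rw [← Real.mul_rpow (norm_nonneg _) hb0]
        exact Real.rpow_le_rpow hc0 hcb hs.le
      refine le_of_mul_le_mul_left ?_ (Real.rpow_pos_of_pos hTpos q.toReal)
      linarith
    · have hc0 := eq_zero_of_attainsNorm hp hq hgt hT hw' hTw' hb hc
      rw [hc0, Real.zero_rpow hs.ne', add_zero,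
        Real.rpow_left_inj (norm_nonneg _) (norm_nonneg _) hs.ne'] at hTsum
      have hx1 : 1 ≤ ‖x‖ := le_of_mul_le_mul_left (by
        rw [mul_one, ← hTsum]
        exact hTsum ▸ T.le_opNorm x) hTpos
      by_contra hne
      linarith [Real.one_le_rpow hx1 hr.le,
        Real.rpow_pos_of_pos (lt_of_le_of_ne hb0 (Ne.symm hne)) p.toReal]
  refine ⟨x, _, hmono, tendsto_iff_norm_sub_tendsto_zero.2 ?_⟩
  simpa only [hb_zero] using hb

end

/-! ### The identity of `ℓ_p` -/

section

variable {𝕜 : Type*} [RCLike 𝕜] {p : ℝ≥0∞} [Fact (1 ≤ p)]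

/-- The normalized sums `e_0 + e_{n+1}` neither tend weakly to zero nor have a convergent
subsequence. -/
theorem exists_isMaximizingSeq_id :
    ∃ u : ℕ → SeqLp 𝕜 p, IsMaximizingSeq (ContinuousLinearMap.id 𝕜 (SeqLp 𝕜 p)) u ∧
      ¬ IsWeaklyNull 𝕜 u ∧ ¬ HasNormConvergentSubseq u := by
  have hp0 : 0 < p := zero_lt_one.trans_le Fact.out
  set z : ℕ → SeqLp 𝕜 p := fun n => lp.single p 0 1 + lp.single p (n + 1) 1 with hz
  have hz0 : ∀ n, z n 0 = 1 := fun n => by simp [hz]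
  have hzs : ∀ n m, z n (m + 1) = if m = n then 1 else 0 := fun n m => by
    simp [hz, Pi.single_apply]
  have hnorm2 : ∀ n, ‖z n‖ ≤ 2 := fun n =>
    (norm_add_le _ _).trans (by rw [lp.norm_single hp0, lp.norm_single hp0]; norm_num)
  have hnorm1 : ∀ n, 0 < ‖z n‖ := fun n =>
    zero_lt_one.trans_le (by simpa [hz0] using lp.norm_apply_le_norm hp0.ne' (z n) 0)
  have hinv : ∀ n, (1 / 2 : ℝ) ≤ ‖z n‖⁻¹ := fun n => by
    rw [← one_div]; exact one_div_le_one_div_of_le (hnorm1 n) (hnorm2 n)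
  set u : ℕ → SeqLp 𝕜 p := fun n => ((‖z n‖⁻¹ : ℝ) : 𝕜) • z n with hu
  have hu1 : ∀ n, ‖u n‖ = 1 := fun n => by
    simp [hu, norm_smul, (hnorm1 n).ne']
  have : Nontrivial (SeqLp 𝕜 p) := ⟨u 0, 0, norm_ne_zero_iff.1 (by simp [hu1])⟩
  refine ⟨u, ⟨hu1, ?_⟩, fun h => ?_, ?_⟩
  · simp [hu1, ContinuousLinearMap.norm_id]
  · have h0 := (h (lp.evalCLM 𝕜 (fun _ : ℕ => 𝕜) p 0)).norm
    refine absurd (ge_of_tendsto' (b := (1 / 2 : ℝ)) h0 fun n => ?_) (by norm_num)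
    change (1 / 2 : ℝ) ≤ ‖u n 0‖
    simpa [hu, hz0] using hinv n
  · rintro ⟨v, φ, hφ, hv⟩
    obtain ⟨N, hN⟩ := Metric.cauchySeq_iff.1 hv.cauchySeq (1 / 2) (by norm_num)
    have hlt := hN N le_rfl (N + 1) N.le_succ
    have hne : φ N ≠ φ (N + 1) := (hφ N.lt_succ_self).ne
    rw [dist_eq_norm] at hlt
    -- The coordinate `φ N + 1` already separates the two vectors.
    have hle := lp.norm_apply_le_norm hp0.ne' (u (φ N) - u (φ (N + 1))) (φ N + 1)
    have heq : ‖(u (φ N) - u (φ (N + 1))) (φ N + 1)‖ = ‖z (φ N)‖⁻¹ := by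
      change ‖((‖z (φ N)‖⁻¹ : ℝ) : 𝕜) * z (φ N) (φ N + 1) -
        ((‖z (φ (N + 1))‖⁻¹ : ℝ) : 𝕜) * z (φ (N + 1)) (φ N + 1)‖ = _
      simp [hzs, hne]
    linarith [hinv (φ N)]

end

theorem theorem2 {𝕜 : Type*} [RCLike 𝕜] :
    (∀ (p q : ℝ≥0∞) [Fact (1 ≤ p)] [Fact (1 ≤ q)],
      1 < p → p ≠ ∞ → q ≠ ∞ → p ≠ q →
      ∀ T : SeqLp 𝕜 p →L[𝕜] SeqLp 𝕜 q, T ≠ 0 → AttainsNorm T →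
      ∀ u : ℕ → SeqLp 𝕜 p, IsMaximizingSeq T u → ¬ IsWeaklyNull 𝕜 u →
        HasNormConvergentSubseq u) ∧
    (∀ (p : ℝ≥0∞) [Fact (1 ≤ p)], 1 < p → p ≠ ∞ →
      ContinuousLinearMap.id 𝕜 (SeqLp 𝕜 p) ≠ 0 ∧
      AttainsNorm (ContinuousLinearMap.id 𝕜 (SeqLp 𝕜 p)) ∧
      ∃ u : ℕ → SeqLp 𝕜 p,
        IsMaximizingSeq (ContinuousLinearMap.id 𝕜 (SeqLp 𝕜 p)) u ∧
        ¬ IsWeaklyNull 𝕜 u ∧ ¬ HasNormConvergentSubseq u) := by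
  refine ⟨fun p q _ _ hp1 hp hq hpq T hT0 hT u hu hwn =>
    hasNormConvergentSubseq_of_isMaximizingSeq hp1 hp hq hpq hT0 hT hu hwn, fun p _ _ _ => ?_⟩
  obtain ⟨u, hu, hwn, hsub⟩ := exists_isMaximizingSeq_id (𝕜 := 𝕜) (p := p)
  have hu0 : u 0 ≠ 0 := norm_ne_zero_iff.1 (by simp [hu.1])
  have : Nontrivial (SeqLp 𝕜 p) := ⟨u 0, 0, hu0⟩
  exact ⟨fun h => hu0 (by simpa using congrArg (fun S => S (u 0)) h),
    ⟨u 0, hu.1 0, by simp [hu.1, ContinuousLinearMap.norm_id]⟩, u, hu, hwn, hsub⟩
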